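/- Let $X$ be a mixed graph on a finite set of $n$ vertices, that is, a finite simple graph $X_U$ (the underlying graph) each of whose edges is either left un-oriented or given exactly one of its two orientations. Let $d_v$ be the degree of $v$ in $X_U$ and $\omega=\frac{1+\mathbf i\sqrt3}{2}$. The Hermitian Randić matrix of the second kind $R^{\omega}(X)=(R_{uv})$ has $R_{uv}=\frac{1}{\sqrt{d_ud_v}}$ if $uv$ is an un-oriented edge, $R_{uv}=\frac{\omega}{\sqrt{d_ud_v}}$ if there is an oriented edge from $u$ to $v$, $R_{uv}=\frac{\overline{\omega}}{\sqrt{d_ud_v}}$ if there is an oriented edge from $v$ to $u$, and $R_{uv}=0$ otherwise. A subgraph of $X$ (with kinds and orientations of edges inherited) is called elementary if each of its connected components is a single edge or a cycle (of length at least $3$), edges and cycles being understood in $X_U$. For a subgraph $Y$ of $X$ put $Q(Y)=\prod_{v\in V(Y)}\frac1{d_v}$, and let $r(Y)$ be the number of vertices of $Y$ minus the number of connected components of $Y$. The value of a cycle $C=v_1v_2\cdots v_\ell v_1$ is $R_{v_1v_2}R_{v_2v_3}\cdots R_{v_\ell v_1}$ (reversing the direction conjugates it); $C$ is called positive or negative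 if its value is a positive or a negative real number, and semi-negative if its value is $-\omega Q(C)$ or $-\overline{\omega}Q(C)$. Let $l_p(Y)$, $l_n(Y)$, $l_{sn}(Y)$ be the numbers of positive, negative and semi-negative cycles in $Y$. Write $\det(xI-R^{\omega}(X))=x^n+a_1x^{n-1}+\cdots+a_n$. Then, for every $1\le k\le n$, $$(-1)^ka_k=\sum_{X'}(-1)^{r(X')+l_n(X')+l_{sn}(X')}\,2^{\,l_n(X')+l_p(X')}\,Q(X'),$$ where the sum is over all elementary subgraphs $X'$ of $X$ with exactly $k$ vertices. -/

import Mathlib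

/-- A mixed graph on `V`: un-oriented edges (a simple graph `edge`) together with oriented edges
(`arc u v` means that there is an oriented edge from `u` to `v`); between two vertices at most one
of the three kinds of edge is present, and there are no loops (`arc_asymm` excludes `arc v v`). -/
structure MixedGraph (V : Type*) where
  edge : SimpleGraph V
  arc : V → V → Prop
  arc_asymm : ∀ u v, arc u v → ¬ arc v u
  arc_not_edge : ∀ u v, arc u v → ¬ edge.Adj u v

namespace MixedGraph

/-- The underlying graph `X_U`: every oriented edge is replaced by an un-oriented one. -/
def underlying {V : Type*} (X : MixedGraph V) : SimpleGraph V where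
  Adj u v := X.edge.Adj u v ∨ X.arc u v ∨ X.arc v u
  symm := ⟨fun u v h => by
    rcases h with h | h | h
    · exact Or.inl h.symm
    · exact Or.inr (Or.inr h)
    · exact Or.inr (Or.inl h)⟩
  loopless := ⟨fun v h => by
    rcases h with h | h | h
    · exact X.edge.loopless.irrefl v h
    · exact X.arc_asymm v v h h
    · exact X.arc_asymm v v h h⟩

/-- The primitive sixth root of unity `(1 + i√3) / 2`. -/
noncomputable def omega : ℂ := (1 + Complex.I * (Real.sqrt 3 : ℂ)) / 2

open Classical in
/-- The degree of a vertex, i.e. its degree in the underlying graph. -/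
noncomputable def degree {V : Type*} [Fintype V] (X : MixedGraph V) (v : V) : ℕ :=
  X.underlying.degree v

open Classical in
/-- The Hermitian adjacency matrix of the second kind. -/
noncomputable def hermitianAdj {V : Type*} (X : MixedGraph V) : Matrix V V ℂ :=
  Matrix.of fun u v =>
    if X.edge.Adj u v then 1
    else if X.arc u v then omega
    else if X.arc v u then starRingEnd ℂ omega
    else 0

/-- The Hermitian Randić matrix of the second kind, with entries `h_uv / √(d_u d_v)`
(entries at non-adjacent pairs are `0` because `h_uv = 0` there). -/
noncomputable def randic {V : Type*} [Fintype V] (X : MixedGraph V) : Matrix V V ℂ :=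
  Matrix.of fun u v =>
    X.hermitianAdj u v / (Real.sqrt ((X.degree u : ℝ) * (X.degree v : ℝ)) : ℂ)

/-- The value of a walk `v₁ v₂ … v_ℓ`: the product of the entries `R_{v₁v₂} R_{v₂v₃} ⋯`. -/
noncomputable def walkValue {V : Type*} [Fintype V] (X : MixedGraph V) {u v : V}
    (w : X.underlying.Walk u v) : ℂ :=
  (w.darts.map fun d => X.randic d.fst d.snd).prod

/-- A subgraph of the mixed graph `X`; as edges keep their kind and orientation, it is the same as
a subgraph of the underlying graph. -/
abbrev Sub {V : Type*} (X : MixedGraph V) : Type _ := X.underlying.Subgraph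

namespace Sub

variable {V : Type*} {X : MixedGraph V}

/-- The subgraph consists of one edge and its two end vertices. -/
def IsEdge (Y : X.Sub) : Prop :=
  ∃ (u v : V) (h : X.underlying.Adj u v), Y = X.underlying.subgraphOfAdj h

/-- The closed walk `w` runs once around the cycle `Y` (in one of its two directions, from some
base point). Recall that cycles have length at least `3`. -/
def IsTraversal (Y : X.Sub) {u : V} (w : X.underlying.Walk u u) : Prop :=
  w.IsCycle ∧ w.toSubgraph = Y

/-- The subgraph is a cycle. -/
def IsCycle (Y : X.Sub) : Prop :=
  ∃ (u : V) (w : X.underlying.Walk u u), Y.IsTraversal w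

/-- A connected component of `Y`, regarded as a subgraph of `X`. -/
def component (Y : X.Sub) (c : Y.coe.ConnectedComponent) : X.Sub :=
  SimpleGraph.Subgraph.coeSubgraph c.toSubgraph

/-- Every connected component is an edge or a cycle. -/
def IsElementary (Y : X.Sub) : Prop :=
  ∀ c : Y.coe.ConnectedComponent, (Y.component c).IsEdge ∨ (Y.component c).IsCycle

/-- The number of vertices of a subgraph. -/
noncomputable def order (Y : X.Sub) : ℕ := Y.verts.ncard

/-- `c(Y)`, the number of connected components. -/
noncomputable def numComponents (Y : X.Sub) : ℕ := Nat.card Y.coe.ConnectedComponent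

/-- `r(Y)`, the number of vertices minus the number of components of `Y`
(the subtraction never truncates when `V` is finite, as components are non-empty). -/
noncomputable def rank (Y : X.Sub) : ℕ := Y.order - Y.numComponents

open Classical in
/-- `Q(Y)`, the product of `1 / d_v` over the vertices `v` of `Y`, where `d_v` is the degree of
`v` in `X`. -/
noncomputable def weight [Fintype V] (Y : X.Sub) : ℝ :=
  ∏ v ∈ Finset.univ.filter (fun v => v ∈ Y.verts), 1 / (X.degree v : ℝ)

/-- A cycle whose value is a positive real number. -/
def IsPositiveCycle [Fintype V] (Y : X.Sub) : Prop :=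
  ∃ (u : V) (w : X.underlying.Walk u u), Y.IsTraversal w ∧
    ∃ t : ℝ, 0 < t ∧ X.walkValue w = (t : ℂ)

/-- A cycle whose value is a negative real number. -/
def IsNegativeCycle [Fintype V] (Y : X.Sub) : Prop :=
  ∃ (u : V) (w : X.underlying.Walk u u), Y.IsTraversal w ∧
    ∃ t : ℝ, t < 0 ∧ X.walkValue w = (t : ℂ)

/-- A cycle `Y` whose value is `-ω Q(Y)` or `-ω̄ Q(Y)`. -/
def IsSemiNegativeCycle [Fintype V] (Y : X.Sub) : Prop :=
  ∃ (u : V) (w : X.underlying.Walk u u), Y.IsTraversal w ∧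
    (X.walkValue w = -omega * (Y.weight : ℂ) ∨
      X.walkValue w = -(starRingEnd ℂ omega) * (Y.weight : ℂ))

/-- `l_p(Y)`, the number of positive cycles contained in `Y`. -/
noncomputable def numPositive [Fintype V] (Y : X.Sub) : ℕ :=
  {C : X.Sub | C ≤ Y ∧ C.IsPositiveCycle}.ncard

/-- `l_n(Y)`, the number of negative cycles contained in `Y`. -/
noncomputable def numNegative [Fintype V] (Y : X.Sub) : ℕ :=
  {C : X.Sub | C ≤ Y ∧ C.IsNegativeCycle}.ncard

/-- `l_sn(Y)`, the number of semi-negative cycles contained in `Y`. -/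
noncomputable def numSemiNegative [Fintype V] (Y : X.Sub) : ℕ :=
  {C : X.Sub | C ≤ Y ∧ C.IsSemiNegativeCycle}.ncard

end Sub

/-- The (finite) set of all elementary subgraphs of `X` with exactly `k` vertices. -/
noncomputable def elementarySubgraphs {V : Type*} [Fintype V] (X : MixedGraph V) (k : ℕ) :
    Finset X.Sub :=
  (Set.toFinite {Y : X.Sub | Y.IsElementary ∧ Y.order = k}).toFinset

end MixedGraph

/-! Expand det(xI − R) over permutations. The diagonal of R vanishes, so a permutation σ with
exactly k moved points contributes only to the degree n − k, and it contributes 0 unless it moves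
points along edges (`SupportsPerm`). Such a σ traces a subgraph (`permSubgraph`): 2-cycles become
single edges and longer cycles become graph cycles, so the traced subgraphs are precisely the
elementary ones (`isElementary_iff`). The sign of σ is (-1)^r (`sign_eq_neg_one_pow_rank`), and the
product of matrix entries is Q times a sixth root of unity `permUnit σ` (`prod_randic_eq`).

It remains to sum over all σ that trace a fixed Y. They differ by the choice of a direction on each
long cycle (`permSubgraph_eq_iff`, `reverseOn_injOn`). Reversal conjugates the unit z of a cycle,
and 2-cycles have unit 1, so the sum of the units factors as the product of z + z̄ over the long
cycles (`sum_permUnit_reverseOn`). This factor is 2 for z = 1, −2 for z = −1, −1 for z = −ω or −ω̄,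
and 1 for z = ω or ω̄ (`add_conj_eq`); these are the signs and powers of 2 of the formula. Finally
`ncard_cycles_eq` turns the numbers of cycles in Y into numbers of long cycles of σ. -/

namespace SimpleGraph

open Equiv Equiv.Perm

/-! ### Subgraphs traced by permutations -/

variable {V : Type*} {G : SimpleGraph V}

/-- The subgraph of `G` formed by the non-fixed points of a permutation `σ` and the edges of `G`
that join a vertex to its image under `σ`. -/
def permSubgraph (G : SimpleGraph V) (σ : Perm V) : G.Subgraph where
  verts := {v | σ v ≠ v}
  Adj u v := G.Adj u v ∧ (σ u = v ∨ σ v = u)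
  adj_sub h := h.1
  edge_vert := by
    rintro u v ⟨h, h' | h'⟩ hu
    · exact h.ne (hu.symm.trans h')
    · exact h.ne (σ.injective (hu.trans h'.symm))
  symm := ⟨fun _ _ h => ⟨h.1.symm, h.2.symm⟩⟩

/-- The permutation `σ` moves each vertex of `G` along an edge or not at all. -/
def SupportsPerm (G : SimpleGraph V) (σ : Perm V) : Prop :=
  ∀ v, σ v ≠ v → G.Adj v (σ v)

@[simp]
theorem mem_verts_permSubgraph {σ : Perm V} {v : V} :
    v ∈ (G.permSubgraph σ).verts ↔ σ v ≠ v := Iff.rfl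

theorem permSubgraph_adj {σ : Perm V} {u v : V} :
    (G.permSubgraph σ).Adj u v ↔ G.Adj u v ∧ (σ u = v ∨ σ v = u) := Iff.rfl

theorem SupportsPerm.permSubgraph_adj {σ : Perm V} (h : G.SupportsPerm σ) {u v : V} :
    (G.permSubgraph σ).Adj u v ↔ u ≠ v ∧ (σ u = v ∨ σ v = u) := by
  refine ⟨fun h' => ⟨h'.1.ne, h'.2⟩, ?_⟩
  rintro ⟨hne, rfl | rfl⟩
  · exact ⟨h u hne.symm, Or.inl rfl⟩
  · exact ⟨(h v hne).symm, Or.inr rfl⟩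

theorem SupportsPerm.inv {σ : Perm V} (h : G.SupportsPerm σ) : G.SupportsPerm σ⁻¹ := by
  intro v hv
  have := h (σ⁻¹ v) (by simpa [eq_comm] using hv)
  simpa using this.symm

theorem permSubgraph_inv (σ : Perm V) : G.permSubgraph σ⁻¹ = G.permSubgraph σ := by
  ext u v
  · simp only [mem_verts_permSubgraph, ne_eq, Perm.inv_eq_iff_eq]
    rw [eq_comm]
  · simp only [permSubgraph_adj, Perm.inv_eq_iff_eq]
    rw [or_comm, eq_comm, @eq_comm _ u]

theorem SupportsPerm.of_apply_eq_or {σ τ : Perm V} (hσ : G.SupportsPerm σ)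
    (h : ∀ v, τ v ≠ v → τ v = σ v ∨ τ v = σ⁻¹ v) : G.SupportsPerm τ := by
  intro v hv
  rcases h v hv with h' | h'
  · rw [h'] at hv ⊢
    exact hσ v hv
  · rw [h'] at hv ⊢
    exact hσ.inv v hv

/-- The only neighbours of v in the subgraph traced by σ are among σ v and σ⁻¹ v, and the edge from
v to τ v lies in that subgraph. All comparisons of permutations below rest on this dichotomy. -/
theorem SupportsPerm.apply_of_le {σ τ : Perm V} (hτ : G.SupportsPerm τ)
    (h : G.permSubgraph τ ≤ G.permSubgraph σ) (v : V) (hv : τ v ≠ v) :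
    τ v = σ v ∨ τ v = σ⁻¹ v := by
  have := h.2 ((hτ.permSubgraph_adj (u := v) (v := τ v)).2 ⟨hv.symm, Or.inl rfl⟩)
  rcases this.2 with h' | h'
  · exact Or.inl h'.symm
  · right
    rw [Perm.eq_inv_iff_eq, h']

/-! ### Graph cycles and cyclic permutations -/

section Walk

/-- If `σ` moves along the arcs of the closed walk `w` and fixes all vertices off `w`, then it
traces the subgraph of `w`. -/
theorem Walk.toSubgraph_eq_permSubgraph {v : V} (w : G.Walk v v) (σ : Perm V)
    (hd : ∀ d ∈ w.darts, σ d.fst = d.snd) (hv : ∀ x, σ x ≠ x → x ∈ w.darts.map (·.fst))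
    (hnil : ¬ w.Nil) :
    w.toSubgraph = G.permSubgraph σ := by
  -- The walk is closed and not nil, so its last vertex is also the start of its first dart.
  have hfst : ∀ x, x ∈ w.support → ∃ d ∈ w.darts, d.fst = x := by
    intro x hx
    rw [← w.map_fst_darts_append, List.mem_append] at hx
    rcases hx with hx | hx
    · simpa using hx
    · obtain rfl : x = v := by simpa using hx
      exact ⟨w.firstDart hnil, w.firstDart_mem_darts hnil, rfl⟩
  ext x y
  · rw [mem_verts_permSubgraph, Walk.mem_verts_toSubgraph]
    constructor
    · intro hx
      obtain ⟨d, hdw, rfl⟩ := hfst x hx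
      rw [hd d hdw]
      exact d.adj.ne'
    · intro hx
      obtain ⟨d, hdw, rfl⟩ := List.mem_map.1 (hv x hx)
      exact w.dart_fst_mem_support_of_mem_darts hdw
  · rw [Walk.adj_toSubgraph_iff_mem_edges, Walk.edges_eq_map_darts, List.mem_map,
      permSubgraph_adj]
    constructor
    · rintro ⟨d, hdw, hxy⟩
      rw [dart_edge_eq_mk'_iff'] at hxy
      rcases hxy with ⟨rfl, rfl⟩ | ⟨rfl, rfl⟩
      · exact ⟨d.adj, Or.inl (hd d hdw)⟩
      · exact ⟨d.adj.symm, Or.inr (hd d hdw)⟩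
    · have key : ∀ x y, G.Adj x y → σ x = y → ∃ d ∈ w.darts, d.edge = s(x, y) := by
        rintro x y hxy rfl
        obtain ⟨d, hdw, rfl⟩ := List.mem_map.1 (hv x hxy.ne')
        refine ⟨d, hdw, ?_⟩
        rw [hd d hdw]
        rfl
      rintro ⟨hxy, h | h⟩
      · exact key x y hxy h
      · rw [Sym2.eq_swap]
        exact key y x hxy.symm h

variable [Fintype V] [DecidableEq V]

/-- A product along a closed walk without repetitions traced by `σ` is a product over the support
of `σ`. -/
theorem Walk.prod_map_darts_eq {M : Type*} [CommMonoid M] {v : V} (w : G.Walk v v) (σ : Perm V)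
    (hd : ∀ d ∈ w.darts, σ d.fst = d.snd) (hv : ∀ x, σ x ≠ x → x ∈ w.darts.map (·.fst))
    (hn : (w.darts.map (·.fst)).Nodup) (f : V → V → M) :
    (w.darts.map fun d => f d.fst d.snd).prod = ∏ x ∈ σ.support, f x (σ x) := by
  have hsupp : σ.support = (w.darts.map (·.fst)).toFinset := by
    ext x
    rw [Perm.mem_support, List.mem_toFinset]
    refine ⟨hv x, fun hx => ?_⟩
    obtain ⟨d, hdw, rfl⟩ := List.mem_map.1 hx
    rw [hd d hdw]
    exact d.adj.ne'
  rw [hsupp, List.prod_toFinset _ hn, List.map_map]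
  congr 1
  refine List.map_congr_left fun d hdw => ?_
  simp [hd d hdw]

/-- A cycle is traced by a cyclic permutation. -/
theorem Walk.IsCycle.exists_perm {v : V} {w : G.Walk v v} (hw : w.IsCycle) :
    ∃ σ : Perm V, σ.IsCycle ∧ 3 ≤ σ.support.card ∧ G.SupportsPerm σ ∧
      w.toSubgraph = G.permSubgraph σ ∧
      ∀ f : V → V → ℂ, (w.darts.map fun d => f d.fst d.snd).prod = ∏ x ∈ σ.support, f x (σ x) := by
  set l := w.darts.map (·.fst) with hl
  have hn : l.Nodup := by
    rw [hl, Walk.map_fst_darts]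
    exact hw.nodup_dropLast_support
  have hlen : l.length = w.length := by simp [hl]
  have h3 : 3 ≤ l.length := hlen ▸ hw.three_le_length
  have hsupp : l.formPerm.support = l.toFinset :=
    List.support_formPerm_of_nodup l hn fun x hx => by rw [hx] at h3; simp at h3
  have hd : ∀ d ∈ w.darts, l.formPerm d.fst = d.snd := by
    intro d hdw
    obtain ⟨i, hi, rfl⟩ := List.getElem_of_mem hdw
    have hi' : i < l.length := by simpa [hl] using hi
    have el : ∀ j (hj : j < l.length), l[j] = w.getVert j := fun j hj => by
      simp [hl, Walk.darts_getElem_eq_getVert]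
    have e : w.darts[i].fst = l[i] := by simp [hl]
    rw [e, List.formPerm_apply_getElem l hn i hi', el, Walk.darts_getElem_eq_getVert, hlen]
    -- `List.formPerm` wraps around at the last dart, whose end is the base point because the walk
    -- is closed.
    rcases Nat.lt_or_ge (i + 1) w.length with h | h
    · rw [Nat.mod_eq_of_lt h]
    · have : i + 1 = w.length := by omega
      simp [this]
  have hv : ∀ x, l.formPerm x ≠ x → x ∈ l := by
    intro x hx
    rwa [← Perm.mem_support, hsupp, List.mem_toFinset] at hx
  refine ⟨l.formPerm, List.isCycle_formPerm hn (by omega), ?_, ?_, ?_, ?_⟩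
  · rwa [hsupp, List.toFinset_card_of_nodup hn]
  · intro x hx
    obtain ⟨d, hdw, rfl⟩ := List.mem_map.1 (hv x hx)
    rw [hd d hdw]
    exact d.adj
  · exact w.toSubgraph_eq_permSubgraph _ hd hv hw.not_nil
  · exact w.prod_map_darts_eq _ hd hv hn

-- The walk follows the orbit of v. Its list of darts is prescribed in full, so that vertices, edges
-- and products along it can all be read off.
omit [Fintype V] [DecidableEq V] in
theorem SupportsPerm.exists_walk {σ : Perm V} (h : G.SupportsPerm σ) {v : V} (hv : σ v ≠ v)
    (n : ℕ) : ∃ w : G.Walk v ((σ ^ n) v),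
      w.darts.map Dart.toProd = (List.range n).map fun i => ((σ ^ i) v, (σ ^ (i + 1)) v) := by
  induction n with
  | zero => exact ⟨Walk.nil, rfl⟩
  | succ n ih =>
    obtain ⟨w, hw⟩ := ih
    have hadj : G.Adj ((σ ^ n) v) ((σ ^ (n + 1)) v) := by
      rw [pow_succ', Perm.mul_apply]
      refine h _ fun h' => hv ?_
      rw [← Perm.mul_apply, ← pow_succ', pow_succ, Perm.mul_apply] at h'
      exact (σ ^ n).injective h'
    refine ⟨w.concat hadj, ?_⟩
    rw [Walk.darts_concat, List.concat_eq_append, List.map_append, hw, List.range_succ,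
      List.map_append]
    rfl

/-- A cyclic permutation along edges that moves at least three vertices is traced by a cycle. -/
theorem SupportsPerm.exists_isCycle {σ : Perm V} (h : G.SupportsPerm σ) (hσ : σ.IsCycle)
    (h3 : 3 ≤ σ.support.card) :
    ∃ (v : V) (w : G.Walk v v), w.IsCycle ∧ w.toSubgraph = G.permSubgraph σ ∧
      ∀ f : V → V → ℂ, (w.darts.map fun d => f d.fst d.snd).prod = ∏ x ∈ σ.support, f x (σ x) := by
  obtain ⟨v, hv, -⟩ := id hσ
  obtain ⟨w, hw⟩ : ∃ w : G.Walk v v, w.darts.map Dart.toProd =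
      (List.range σ.support.card).map fun i => ((σ ^ i) v, (σ ^ (i + 1)) v) := by
    -- The order of a cyclic permutation is the size of its support, so the orbit walk closes after
    -- that many steps.
    have e : (σ ^ σ.support.card) v = v := by
      rw [← hσ.orderOf, pow_orderOf_eq_one, Perm.one_apply]
    obtain ⟨w, hw⟩ := h.exists_walk hv σ.support.card
    exact ⟨w.copy rfl e, by rw [Walk.darts_copy, hw]⟩
  have hinj : ∀ i < σ.support.card, ∀ j < σ.support.card, (σ ^ i) v = (σ ^ j) v → i = j := by
    intro i hi j hj hij
    rw [← hσ.orderOf] at hi hj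
    exact pow_injOn_Iio_orderOf hi hj
      (hσ.pow_eq_pow_iff.2 ⟨v, hv, hij⟩)
  have hfst : w.darts.map (·.fst) = (List.range σ.support.card).map fun i => (σ ^ i) v := by
    have := congrArg (List.map Prod.fst) hw
    rwa [List.map_map, List.map_map] at this
  have hsnd : w.darts.map (·.snd) = (List.range σ.support.card).map fun i => (σ ^ (i + 1)) v := by
    have := congrArg (List.map Prod.snd) hw
    rwa [List.map_map, List.map_map] at this
  have hedges : w.edges =
      (List.range σ.support.card).map fun i => s((σ ^ i) v, (σ ^ (i + 1)) v) := by
    have := congrArg (List.map Sym2.mk.uncurry) hw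
    rw [List.map_map, List.map_map] at this
    rw [Walk.edges_eq_map_darts]
    exact this
  have hd : ∀ d ∈ w.darts, σ d.fst = d.snd := by
    intro d hdw
    have : d.toProd ∈ w.darts.map Dart.toProd := List.mem_map_of_mem hdw
    rw [hw, List.mem_map] at this
    obtain ⟨i, -, hi⟩ := this
    rw [← hi, pow_succ', Perm.mul_apply]
  have hvert : ∀ x, σ x ≠ x → x ∈ w.darts.map (·.fst) := by
    intro x hx
    obtain ⟨i, hi, rfl⟩ := (hσ.sameCycle hv hx).exists_pow_eq'
    rw [hfst, List.mem_map]
    exact ⟨i, List.mem_range.2 (hσ.orderOf ▸ hi), rfl⟩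
  have hn : (w.darts.map (·.fst)).Nodup := by
    rw [hfst]
    refine List.Nodup.map_on ?_ List.nodup_range
    intro i hi j hj hij
    exact hinj i (List.mem_range.1 hi) j (List.mem_range.1 hj) hij
  have hnil : ¬ w.Nil := by
    intro h0
    rw [← Walk.darts_eq_nil] at h0
    rw [h0] at hw
    have := congrArg List.length hw
    simp at this
    omega
  refine ⟨v, w, ?_, w.toSubgraph_eq_permSubgraph _ hd hvert hnil, w.prod_map_darts_eq _ hd hvert hn⟩
  rw [Walk.isCycle_def]
  refine ⟨⟨?_⟩, fun h0 => hnil (by rw [h0]; exact Walk.Nil.nil), ?_⟩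
  · rw [hedges]
    refine List.Nodup.map_on ?_ List.nodup_range
    intro i hi j hj hij
    rw [List.mem_range] at hi hj
    rw [Sym2.eq_iff] at hij
    rcases hij with ⟨h1, -⟩ | ⟨h1, h2⟩
    · exact hinj i hi j hj h1
    -- An edge repeated in the opposite direction would make σ² fix a point of the orbit, which is
    -- impossible for a cycle of length at least 3.
    · exfalso
      have h4 : (σ ^ 2) ((σ ^ j) v) = (σ ^ j) v := by
        rw [pow_succ', Perm.mul_apply] at h1 h2
        rw [sq, Perm.mul_apply, ← h1, h2]
      rw [← Perm.mul_apply, ← pow_add, add_comm, pow_add, Perm.mul_apply] at h4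
      have := hinj 2 (by omega) 0 (by omega) ((σ ^ j).injective h4)
      omega
  · rw [← Walk.map_snd_darts, hsnd]
    refine List.Nodup.map_on ?_ List.nodup_range
    intro i hi j hj hij
    simp only [pow_succ', Perm.mul_apply] at hij
    exact hinj i (List.mem_range.1 hi) j (List.mem_range.1 hj) (σ.injective hij)

end Walk

/-! ### Components and cycle factors -/

section Components

theorem Subgraph.mem_verts_coeSubgraph_connectedComponent {Y : G.Subgraph}
    {c : Y.coe.ConnectedComponent} {x : V} :
    x ∈ (Subgraph.coeSubgraph c.toSubgraph).verts ↔
      ∃ h : x ∈ Y.verts, Y.coe.connectedComponentMk ⟨x, h⟩ = c := by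
  simp

theorem Subgraph.coeSubgraph_connectedComponent_adj {Y : G.Subgraph}
    {c : Y.coe.ConnectedComponent} {x y : V} :
    (Subgraph.coeSubgraph c.toSubgraph).Adj x y ↔
      Y.Adj x y ∧ ∃ h : x ∈ Y.verts, Y.coe.connectedComponentMk ⟨x, h⟩ = c := by
  rw [Subgraph.coeSubgraph_adj]
  constructor
  · rintro ⟨hx, hy, h1, -, h2⟩
    exact ⟨h2, hx, h1⟩
  · rintro ⟨h, hx, rfl⟩
    have hadj : Y.coe.Adj ⟨x, hx⟩ ⟨y, h.snd_mem⟩ := h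
    exact ⟨hx, h.snd_mem, rfl, ConnectedComponent.sound hadj.symm.reachable, hadj⟩

/-- If every component of `Y` is traced by a permutation, then so is `Y`. -/
theorem Subgraph.exists_perm_of_components [Finite V] {Y : G.Subgraph}
    (h : ∀ c : Y.coe.ConnectedComponent, ∃ τ : Perm V, G.SupportsPerm τ ∧
      Subgraph.coeSubgraph c.toSubgraph = G.permSubgraph τ) :
    ∃ σ : Perm V, G.SupportsPerm σ ∧ Y = G.permSubgraph σ := by
  classical
  choose τ hτ hτY using h
  -- ρ v is the permutation chosen for the component of v, and the identity off Y. The glued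
  -- permutation is v ↦ ρ v v; it is injective because ρ v keeps v in its component.
  set ρ : V → Perm V := fun v =>
    if h : v ∈ Y.verts then τ (Y.coe.connectedComponentMk ⟨v, h⟩) else 1 with hρ
  have hmem : ∀ u v (hv : v ∈ Y.verts), ρ v u ≠ u ↔ ∃ hu : u ∈ Y.verts,
      Y.coe.connectedComponentMk ⟨u, hu⟩ = Y.coe.connectedComponentMk ⟨v, hv⟩ := by
    intro u v hv
    rw [← mem_verts_permSubgraph (G := G)]
    simp only [hρ, dif_pos hv]
    rw [← hτY, Subgraph.mem_verts_coeSubgraph_connectedComponent]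
  have hmove : ∀ v ∈ Y.verts, ρ v v ≠ v := fun v hv => (hmem v v hv).2 ⟨hv, rfl⟩
  have hconst : ∀ u v, v ∈ Y.verts → ρ v u ≠ u → u ∈ Y.verts ∧ ρ u = ρ v := by
    intro u v hv huv
    obtain ⟨hu, e⟩ := (hmem u v hv).1 huv
    exact ⟨hu, by simp only [hρ, dif_pos hu, dif_pos hv, e]⟩
  have hstep : ∀ v ∈ Y.verts, ρ v v ∈ Y.verts ∧ ρ (ρ v v) = ρ v := by
    intro v hv
    exact hconst _ _ hv fun e => hmove v hv ((ρ v).injective e)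
  have hfix : ∀ v, v ∉ Y.verts → ρ v v = v := fun v hv => by simp [hρ, dif_neg hv]
  have hadj : ∀ u v, Y.Adj u v ↔ u ∈ Y.verts ∧ (G.permSubgraph (ρ u)).Adj u v := by
    intro u v
    constructor
    · intro huv
      refine ⟨huv.fst_mem, ?_⟩
      simp only [hρ, dif_pos huv.fst_mem]
      rw [← hτY, Subgraph.coeSubgraph_connectedComponent_adj]
      exact ⟨huv, huv.fst_mem, rfl⟩
    · rintro ⟨hu, huv⟩
      simp only [hρ, dif_pos hu] at huv
      rw [← hτY, Subgraph.coeSubgraph_connectedComponent_adj] at huv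
      exact huv.1
  have hinj : Function.Injective fun v => ρ v v := by
    intro u v huv
    dsimp only at huv
    by_cases hu : u ∈ Y.verts <;> by_cases hv : v ∈ Y.verts
    · have e : ρ u = ρ v := by rw [← (hstep u hu).2, huv, (hstep v hv).2]
      rw [e] at huv
      exact (ρ v).injective huv
    · rw [hfix v hv] at huv
      exact absurd (huv ▸ (hstep u hu).1) hv
    · rw [hfix u hu] at huv
      exact absurd (huv ▸ (hstep v hv).1) hu
    · rwa [hfix u hu, hfix v hv] at huv
  refine ⟨Equiv.ofBijective _ (Finite.injective_iff_bijective.1 hinj), ?_, ?_⟩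
  · intro v hv
    rw [Equiv.ofBijective_apply] at hv ⊢
    have hvY : v ∈ Y.verts := by
      by_contra h
      exact hv (hfix v h)
    simp only [hρ, dif_pos hvY] at hv ⊢
    exact hτ _ v hv
  · ext u v
    · rw [mem_verts_permSubgraph, Equiv.ofBijective_apply]
      refine ⟨hmove u, fun h => ?_⟩
      by_contra h'
      exact h (hfix u h')
    · rw [permSubgraph_adj, Equiv.ofBijective_apply, Equiv.ofBijective_apply]
      constructor
      · intro huv
        refine ⟨huv.adj_sub, ?_⟩
        obtain ⟨hu, hGuv, h | h⟩ := (hadj u v).1 huv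
        · exact Or.inl h
        · right
          rwa [(hconst v u hu (h.trans_ne hGuv.ne)).2]
      · have key : ∀ u v, G.Adj u v → ρ u u = v → Y.Adj u v := by
          intro u v huv h
          have hu : u ∈ Y.verts := by
            by_contra h'
            exact huv.ne ((hfix u h').symm.trans h)
          exact (hadj u v).2 ⟨hu, huv, Or.inl h⟩
        rintro ⟨huv, h | h⟩
        · exact key u v huv h
        · exact (key v u huv.symm h).symm

variable [Fintype V] [DecidableEq V]

omit [DecidableEq V] in
theorem SupportsPerm.reachable_iff_sameCycle {σ : Perm V} (h : G.SupportsPerm σ)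
    (u v : (G.permSubgraph σ).verts) :
    (G.permSubgraph σ).coe.Reachable u v ↔ σ.SameCycle u v := by
  constructor
  · rintro ⟨p⟩
    induction p with
    | nil => rfl
    | cons hadj p ih =>
      refine SameCycle.trans ?_ ih
      rcases hadj.2 with h' | h'
      · rw [← h']
        exact sameCycle_apply_right.2 SameCycle.rfl
      · rw [← h']
        exact sameCycle_apply_left.2 SameCycle.rfl
  · intro huv
    obtain ⟨n, -, hn⟩ := huv.exists_pow_eq'
    obtain ⟨u, hu⟩ := u
    obtain ⟨v, hv⟩ := v
    dsimp only at hn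
    subst hn
    clear huv
    induction n with
    | zero => rfl
    | succ n ih =>
      have hn : σ ((σ ^ n) u) ≠ (σ ^ n) u := by
        rw [← Perm.mul_apply, ← pow_succ', pow_succ, Perm.mul_apply]
        exact fun e => hu ((σ ^ n).injective e)
      refine (ih hn).trans (Adj.reachable ?_)
      refine (h.permSubgraph_adj (u := (σ ^ n) u) (v := (σ ^ (n + 1)) u)).2 ⟨?_, Or.inl ?_⟩
      · rw [pow_succ', Perm.mul_apply]
        exact hn.symm
      · rw [pow_succ', Perm.mul_apply]

theorem SupportsPerm.cycleOf {σ : Perm V} (h : G.SupportsPerm σ) (v : V) :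
    G.SupportsPerm (σ.cycleOf v) := by
  intro x hx
  rw [cycleOf_apply] at hx ⊢
  split_ifs at hx ⊢ with hs
  · exact h x hx
  · exact absurd rfl hx

/-- Reachability in the traced subgraph is being in the same cycle of σ, and on that cycle `cycleOf`
agrees with σ. -/
theorem SupportsPerm.component_eq {σ : Perm V} (h : G.SupportsPerm σ)
    (v : (G.permSubgraph σ).verts) :
    Subgraph.coeSubgraph ((G.permSubgraph σ).coe.connectedComponentMk v).toSubgraph =
      G.permSubgraph (σ.cycleOf v) := by
  have hmem : ∀ x : V, (∃ hx : x ∈ (G.permSubgraph σ).verts,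
      (G.permSubgraph σ).coe.connectedComponentMk ⟨x, hx⟩ =
        (G.permSubgraph σ).coe.connectedComponentMk v) ↔ σ.SameCycle v x := by
    intro x
    simp only [ConnectedComponent.eq, h.reachable_iff_sameCycle]
    refine ⟨fun ⟨_, hx⟩ => hx.symm, fun hx => ⟨?_, hx.symm⟩⟩
    exact fun e => v.2 (hx.apply_eq_self_iff.2 e)
  have hsame : ∀ x, σ.SameCycle v x → σ x ≠ x := fun x hx e => v.2 (hx.apply_eq_self_iff.2 e)
  ext x y
  · rw [Subgraph.mem_verts_coeSubgraph_connectedComponent, hmem, mem_verts_permSubgraph,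
      cycleOf_apply]
    split_ifs with hs
    · simp [hs, hsame x hs]
    · simp [hs]
  · rw [Subgraph.coeSubgraph_connectedComponent_adj, hmem, h.permSubgraph_adj,
      (h.cycleOf v).permSubgraph_adj, cycleOf_apply, cycleOf_apply]
    constructor
    · rintro ⟨⟨hne, hxy⟩, hs⟩
      refine ⟨hne, ?_⟩
      have hs' : σ.SameCycle v y := by
        rcases hxy with rfl | rfl
        · exact sameCycle_apply_right.2 hs
        · exact sameCycle_apply_right.1 hs
      rwa [if_pos hs, if_pos hs']
    · rintro ⟨hne, hxy⟩
      by_cases hs : σ.SameCycle v x <;> by_cases hs' : σ.SameCycle v y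
      · rw [if_pos hs, if_pos hs'] at hxy
        exact ⟨⟨hne, hxy⟩, hs⟩
      · rw [if_pos hs, if_neg hs'] at hxy
        rcases hxy with rfl | rfl
        · exact absurd (sameCycle_apply_right.2 hs) hs'
        · exact absurd rfl hne
      · rw [if_neg hs, if_pos hs'] at hxy
        rcases hxy with rfl | rfl
        · exact absurd rfl hne
        · exact absurd (sameCycle_apply_right.2 hs') hs
      · rw [if_neg hs, if_neg hs'] at hxy
        rcases hxy with rfl | rfl <;> exact absurd rfl hne

theorem SupportsPerm.card_connectedComponent {σ : Perm V} (h : G.SupportsPerm σ) :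
    Nat.card (G.permSubgraph σ).coe.ConnectedComponent = σ.cycleFactorsFinset.card := by
  let f : (G.permSubgraph σ).coe.ConnectedComponent → σ.cycleFactorsFinset :=
    fun c => c.lift
      (fun v : (G.permSubgraph σ).verts =>
        ⟨σ.cycleOf v, cycleOf_mem_cycleFactorsFinset_iff.2 (Perm.mem_support.2 v.2)⟩)
      (fun (u v : (G.permSubgraph σ).verts) p _ =>
        Subtype.ext ((h.reachable_iff_sameCycle u v).1 p.reachable).cycleOf_eq)
  have hf : Function.Bijective f := by
    constructor
    · intro c d
      induction c using ConnectedComponent.ind with | _ u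
      induction d using ConnectedComponent.ind with | _ v
      intro e
      have e' : σ.cycleOf u = σ.cycleOf v := congrArg Subtype.val e
      refine ConnectedComponent.sound ((h.reachable_iff_sameCycle u v).2 ?_)
      by_contra hs
      have h1 := cycleOf_apply_self σ (v : V)
      rw [← e', cycleOf_apply_of_not_sameCycle hs] at h1
      exact v.2 h1.symm
    · rintro ⟨c, hc⟩
      obtain ⟨x, hx⟩ := (mem_cycleFactorsFinset_iff.1 hc).1.nonempty_support
      refine ⟨(G.permSubgraph σ).coe.connectedComponentMk
        ⟨x, Perm.mem_support.1 (mem_cycleFactorsFinset_support_le hc hx)⟩, Subtype.ext ?_⟩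
      exact (cycle_is_cycleOf hx hc).symm
  rw [Nat.card_eq_of_bijective f hf, Nat.card_eq_fintype_card, Fintype.card_coe]

end Components

end SimpleGraph

/-! ### Long cycles and their reversal -/

namespace Equiv.Perm

variable {V : Type*} [Fintype V] [DecidableEq V]

/-- The cycles of `σ` of length at least three. -/
def longCycles (σ : Perm V) : Finset (Perm V) :=
  σ.cycleFactorsFinset.filter fun c => 3 ≤ c.support.card

theorem IsCycle.apply_apply_ne {c : Perm V} (hc : c.IsCycle) (h3 : 3 ≤ c.support.card) {v : V}
    (hv : c v ≠ v) : c (c v) ≠ v := by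
  intro h
  have h2 : c ^ 2 = 1 := (hc.pow_eq_one_iff' hv).2 (by rwa [sq, mul_apply])
  have := orderOf_le_of_pow_eq_one two_pos h2
  rw [hc.orderOf] at this
  omega

theorem IsCycle.apply_apply_of_card_lt {c : Perm V} (hc : c.IsCycle) (h3 : c.support.card < 3)
    (v : V) : c (c v) = v := by
  have h2 := hc.two_le_card_support
  have : c ^ 2 = 1 := by
    rw [show 2 = c.support.card by omega, ← hc.orderOf, pow_orderOf_eq_one]
  rw [← mul_apply, ← sq, this, one_apply]

theorem prod_support_eq_prod_cycleFactorsFinset {M : Type*} [CommMonoid M] (σ : Perm V)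
    (f : V → M) :
    ∏ x ∈ σ.support, f x = ∏ c ∈ σ.cycleFactorsFinset, ∏ x ∈ c.support, f x := by
  rw [← Finset.prod_fiberwise_of_maps_to (g := σ.cycleOf)
    (fun x hx => cycleOf_mem_cycleFactorsFinset_iff.2 hx)]
  refine Finset.prod_congr rfl fun c hc => Finset.prod_congr ?_ fun _ _ => rfl
  ext x
  rw [Finset.mem_filter]
  constructor
  · rintro ⟨hx, rfl⟩
    exact mem_support_cycleOf_iff.2 ⟨SameCycle.rfl, hx⟩
  · intro hx
    exact ⟨mem_cycleFactorsFinset_support_le hc hx, (cycle_is_cycleOf hx hc).symm⟩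

/-- Reverse the cycles of `σ` that belong to `T`. -/
def reverseOn (σ : Perm V) (T : Finset (Perm V)) : Perm V where
  toFun v := if σ.cycleOf v ∈ T then σ⁻¹ v else σ v
  invFun v := if σ.cycleOf v ∈ T then σ v else σ⁻¹ v
  left_inv v := by
    have h1 : σ.cycleOf (σ v) = σ.cycleOf v :=
      (sameCycle_apply_left.2 SameCycle.rfl).cycleOf_eq
    have h2 : σ.cycleOf (σ⁻¹ v) = σ.cycleOf v :=
      SameCycle.cycleOf_eq ⟨1, by simp⟩
    by_cases h : σ.cycleOf v ∈ T <;> simp only [h, h1, h2, if_true, if_false] <;> simp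
  right_inv v := by
    have h1 : σ.cycleOf (σ v) = σ.cycleOf v :=
      (sameCycle_apply_left.2 SameCycle.rfl).cycleOf_eq
    have h2 : σ.cycleOf (σ⁻¹ v) = σ.cycleOf v :=
      SameCycle.cycleOf_eq ⟨1, by simp⟩
    by_cases h : σ.cycleOf v ∈ T <;> simp only [h, h1, h2, if_true, if_false] <;> simp

theorem reverseOn_apply (σ : Perm V) (T : Finset (Perm V)) (v : V) :
    σ.reverseOn T v = if σ.cycleOf v ∈ T then σ⁻¹ v else σ v := rfl

theorem reverseOn_apply_eq_or (σ : Perm V) (T : Finset (Perm V)) (v : V) :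
    σ.reverseOn T v = σ v ∨ σ.reverseOn T v = σ⁻¹ v := by
  rw [reverseOn_apply]
  split_ifs
  · exact Or.inr rfl
  · exact Or.inl rfl

/-- When one of u, v is the image of the other, both lie on one cycle of σ; reversing it merely
exchanges the two alternatives. -/
theorem reverseOn_apply_eq_iff (σ : Perm V) (T : Finset (Perm V)) (u v : V) :
    (σ.reverseOn T u = v ∨ σ.reverseOn T v = u) ↔ (σ u = v ∨ σ v = u) := by
  have h1 : σ u = v → σ.cycleOf u = σ.cycleOf v := by
    rintro rfl
    exact (sameCycle_apply_right.2 SameCycle.rfl).cycleOf_eq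
  have h2 : σ v = u → σ.cycleOf u = σ.cycleOf v := by
    rintro rfl
    exact (sameCycle_apply_left.2 SameCycle.rfl).cycleOf_eq
  simp only [reverseOn_apply]
  by_cases hu : σ.cycleOf u ∈ T <;> by_cases hv : σ.cycleOf v ∈ T <;>
    simp only [hu, hv, if_true, if_false, inv_eq_iff_eq] <;> grind

/-- A cycle of length at least 3 differs from its inverse at each point of its support, so the set
of reversed long cycles can be recovered. -/
theorem reverseOn_injOn (σ : Perm V) :
    Set.InjOn σ.reverseOn (σ.longCycles.powerset : Finset (Finset (Perm V))) := by
  have key : ∀ S T : Finset (Perm V), S ⊆ σ.longCycles → σ.reverseOn S = σ.reverseOn T → S ⊆ T := by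
    intro S T hS hST c hc
    have hcl := hS hc
    rw [longCycles, Finset.mem_filter] at hcl
    obtain ⟨hcf, h3⟩ := hcl
    have hcc := (mem_cycleFactorsFinset_iff.1 hcf).1
    obtain ⟨x, hx⟩ := hcc.nonempty_support
    have hxc := cycle_is_cycleOf hx hcf
    have e := congrArg (fun τ : Perm V => τ x) hST
    by_contra hcT
    simp only [reverseOn_apply, ← hxc, hc, hcT, if_true, if_false] at e
    rw [inv_eq_iff_eq] at e
    have hcx : c x = σ x := (mem_cycleFactorsFinset_iff.1 hcf).2 x hx
    refine hcc.apply_apply_ne h3 (mem_support.1 hx) ?_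
    rw [(mem_cycleFactorsFinset_iff.1 hcf).2 _ (apply_mem_support.2 hx), hcx, ← e]
  intro S hS T hT h
  simp only [Finset.coe_powerset, Set.mem_preimage, Set.mem_powerset_iff, Finset.coe_subset]
    at hS hT
  exact (key S T hS h).antisymm (key T S hT h.symm)

end Equiv.Perm

/-! ### Permutations tracing the same subgraph -/

namespace SimpleGraph

open Equiv Equiv.Perm

variable {V : Type*} {G : SimpleGraph V}

/-- If `τ` agrees with `σ` or `σ⁻¹` at each non-fixed point, then agreement with `σ` propagates
along the orbits of `τ`. -/
theorem apply_pow_eq_of_apply_eq {σ τ : Perm V} (hτ : ∀ u, τ u ≠ u → τ u = σ u ∨ τ u = σ⁻¹ u)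
    (h2 : ∀ v, τ v ≠ v → τ v = σ v → τ (τ v) = v → σ (σ v) = v) {v : V} (hv : τ v ≠ v)
    (e : τ v = σ v) (n : ℕ) : τ ((τ ^ n) v) = σ ((τ ^ n) v) := by
  induction n with
  | zero => exact e
  | succ n ih =>
    have hn : τ ((τ ^ n) v) ≠ (τ ^ n) v := by
      rw [← Perm.mul_apply, ← pow_succ', pow_succ, Perm.mul_apply]
      exact fun e => hv ((τ ^ n).injective e)
    rw [pow_succ', Perm.mul_apply]
    generalize (τ ^ n) v = u at *
    rcases hτ (τ u) (fun e => hn (τ.injective e)) with h | h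
    -- Otherwise τ turns back and is a 2-cycle at u; then `h2` makes σ turn back there as well, and
    -- the two still agree.
    · exact h
    · have h' : τ (τ u) = u := by
        rw [h, Perm.inv_eq_iff_eq, ih]
      rw [h', ih]
      exact (h2 u hn ih h').symm

variable [Fintype V] [DecidableEq V]

theorem SupportsPerm.mem_cycleFactorsFinset_of_apply_eq {σ τ : Perm V} (hτ : G.SupportsPerm τ)
    (hc : τ.IsCycle) (h3 : 3 ≤ τ.support.card) (hle : G.permSubgraph τ ≤ G.permSubgraph σ)
    {v : V} (hv : τ v ≠ v) (e : τ v = σ v) : τ ∈ σ.cycleFactorsFinset := by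
  rw [mem_cycleFactorsFinset_iff]
  refine ⟨hc, fun a ha => ?_⟩
  obtain ⟨n, -, rfl⟩ := (hc.sameCycle hv (Perm.mem_support.1 ha)).exists_pow_eq'
  exact apply_pow_eq_of_apply_eq (hτ.apply_of_le hle)
    (fun u hu _ h => absurd h (hc.apply_apply_ne h3 hu)) hv e n

/-- A cycle contained in the subgraph traced by `σ` is, up to reversal, one of the cycles
of `σ`. -/
theorem SupportsPerm.mem_cycleFactorsFinset_of_le {σ τ : Perm V} (hτ : G.SupportsPerm τ)
    (hc : τ.IsCycle) (h3 : 3 ≤ τ.support.card) (hle : G.permSubgraph τ ≤ G.permSubgraph σ) :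
    τ ∈ σ.cycleFactorsFinset ∨ τ⁻¹ ∈ σ.cycleFactorsFinset := by
  obtain ⟨v, hv, -⟩ := id hc
  rcases hτ.apply_of_le hle v hv with e | e
  · exact Or.inl (hτ.mem_cycleFactorsFinset_of_apply_eq hc h3 hle hv e)
  · right
    -- σ⁻¹ traces the same subgraph as σ, so the previous case applies to σ⁻¹.
    have := hτ.mem_cycleFactorsFinset_of_apply_eq hc h3
      (hle.trans_eq (permSubgraph_inv σ).symm) hv e
    rw [mem_cycleFactorsFinset_iff] at this ⊢
    refine ⟨hc.inv, fun a ha => ?_⟩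
    have ha' : τ⁻¹ a ∈ τ.support := by
      rw [Perm.support_inv] at ha
      rw [Perm.mem_support, ne_eq, Perm.eq_inv_iff_eq]
      simpa [Perm.mem_support] using ha
    have h' := this.2 _ ha'
    rw [Perm.eq_inv_iff_eq] at h'
    simpa using h'.symm

omit [DecidableEq V] in
theorem SupportsPerm.apply_eq_of_sameCycle {σ τ : Perm V} (hσ : G.SupportsPerm σ)
    (hτ : G.SupportsPerm τ) (h : G.permSubgraph τ = G.permSubgraph σ) {u v : V} (hv : σ v ≠ v)
    (e : τ v = σ v) (huv : σ.SameCycle v u) : τ u = σ u := by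
  obtain ⟨n, -, rfl⟩ := huv.exists_pow_eq'
  refine (apply_pow_eq_of_apply_eq (hσ.apply_of_le h.ge) ?_ hv e.symm n).symm
  intro x hx hxe hxx
  have hx' : τ⁻¹ x ≠ x := by
    rw [ne_eq, Perm.inv_eq_iff_eq, ← hxe]
    exact hx.symm
  -- Since σ is a 2-cycle at x, the only neighbour of x in the common subgraph is σ x, so τ must
  -- come from there too.
  have : τ⁻¹ x = σ x := by
    rcases hτ.inv.apply_of_le ((permSubgraph_inv τ).trans h).le x hx' with h' | h'
    · exact h'
    · rw [h', Perm.inv_eq_iff_eq, hxx]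
  rw [Perm.inv_eq_iff_eq] at this
  rw [← hxe]
  exact this.symm

theorem SupportsPerm.reverseOn {σ : Perm V} (h : G.SupportsPerm σ) (T : Finset (Perm V)) :
    G.SupportsPerm (σ.reverseOn T) :=
  h.of_apply_eq_or fun v _ => σ.reverseOn_apply_eq_or T v

theorem permSubgraph_reverseOn (σ : Perm V) (T : Finset (Perm V)) :
    G.permSubgraph (σ.reverseOn T) = G.permSubgraph σ := by
  ext u v
  · have := reverseOn_apply_eq_iff σ T u u
    rw [or_self, or_self] at this
    exact not_congr this
  · exact and_congr_right fun _ => reverseOn_apply_eq_iff σ T u v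

/-- The permutations that trace the same subgraph as `σ` arise by reversing long cycles. -/
theorem SupportsPerm.permSubgraph_eq_iff {σ τ : Perm V} (hσ : G.SupportsPerm σ) :
    G.SupportsPerm τ ∧ G.permSubgraph τ = G.permSubgraph σ ↔
      τ ∈ σ.longCycles.powerset.image σ.reverseOn := by
  rw [Finset.mem_image]
  constructor
  · rintro ⟨hτ, h⟩
    have hfix : ∀ v, σ v = v → τ v = v := by
      intro v hv
      by_contra hv'
      have : v ∈ (G.permSubgraph τ).verts := hv'
      rw [h] at this
      exact this hv
    -- The reversed cycles are the long cycles of σ on which τ agrees with σ⁻¹.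
    refine ⟨σ.longCycles.filter fun c => ∀ v ∈ c.support, τ v = σ⁻¹ v,
      Finset.mem_powerset.2 (Finset.filter_subset _ _), Equiv.ext fun v => ?_⟩
    rw [reverseOn_apply]
    by_cases hv : σ v = v
    · rw [hfix v hv, hv, Perm.inv_eq_iff_eq.2 hv.symm, ite_self]
    have hvs : v ∈ (σ.cycleOf v).support :=
      mem_support_cycleOf_iff.2 ⟨SameCycle.rfl, Perm.mem_support.2 hv⟩
    split_ifs with hT
    · exact ((Finset.mem_filter.1 hT).2 v hvs).symm
    · have hτv : τ v ≠ v := by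
        have : v ∈ (G.permSubgraph σ).verts := hv
        rwa [← h] at this
      rcases hτ.apply_of_le h.le v hτv with e | e
      · exact e.symm
      · have hinv : ∀ u ∈ (σ.cycleOf v).support, τ u = σ⁻¹ u := by
          intro u hu
          refine hσ.inv.apply_eq_of_sameCycle hτ (h.trans (permSubgraph_inv σ).symm)
            (e ▸ hτv) e ?_
          exact sameCycle_inv.2 (mem_support_cycleOf_iff.1 hu).1
        have hcf := cycleOf_mem_cycleFactorsFinset_iff.2 (Perm.mem_support.2 hv)
        -- Here τ inverts the cycle of v although that cycle is not in the chosen set. Hence it is a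
        -- 2-cycle, where σ and σ⁻¹ coincide.
        have h3 : (σ.cycleOf v).support.card < 3 := by
          by_contra h3
          refine hT (Finset.mem_filter.2 ⟨Finset.mem_filter.2 ⟨hcf, not_lt.1 h3⟩, hinv⟩)
        have := (mem_cycleFactorsFinset_iff.1 hcf).1.apply_apply_of_card_lt h3 v
        rw [cycleOf_apply_self, cycleOf_apply_apply_self] at this
        rw [e, eq_comm, Perm.inv_eq_iff_eq, this]
  · rintro ⟨T, -, rfl⟩
    exact ⟨hσ.reverseOn T, permSubgraph_reverseOn σ T⟩

end SimpleGraph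

/-! ### Coefficients of the characteristic polynomial -/

theorem Matrix.neg_one_pow_mul_charpoly_coeff_of_diag_eq_zero {R n : Type*} [CommRing R] [Fintype n]
    [DecidableEq n] (M : Matrix n n R) (hM : ∀ i, M i i = 0) {k : ℕ} (hk : k ≤ Fintype.card n) :
    (-1) ^ k * M.charpoly.coeff (Fintype.card n - k) =
      ∑ σ : Equiv.Perm n with σ.support.card = k,
        (Equiv.Perm.sign σ : R) * ∏ i ∈ σ.support, M i (σ i) := by
  open Polynomial in
  have hterm : ∀ σ : Equiv.Perm n, ∏ i, M.charmatrix i (σ i) =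
      C ((-1) ^ σ.support.card * ∏ i ∈ σ.support, M i (σ i)) *
        X ^ (Fintype.card n - σ.support.card) := by
    intro σ
    rw [← Finset.prod_mul_prod_compl σ.support, map_mul, map_pow, map_prod, map_neg, map_one,
      ← Finset.prod_const, ← Finset.prod_mul_distrib, ← Finset.card_compl, ← Finset.prod_const]
    congr 1
    · refine Finset.prod_congr rfl fun i hi => ?_
      rw [Matrix.charmatrix_apply_ne _ _ _ (Equiv.Perm.mem_support.1 hi).symm, neg_one_mul]
    · refine Finset.prod_congr rfl fun i hi => ?_
      rw [Finset.mem_compl, Equiv.Perm.notMem_support] at hi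
      rw [hi, Matrix.charmatrix_apply_eq, hM, map_zero, sub_zero]
  -- `Matrix.det_apply'` uses the entries at (σ i, i); transposing puts them at (i, σ i).
  rw [Matrix.charpoly, ← Matrix.det_transpose, Matrix.det_apply', Polynomial.finsetSum_coeff,
    Finset.mul_sum, Finset.sum_filter]
  refine Finset.sum_congr rfl fun σ _ => ?_
  simp only [Matrix.transpose_apply]
  rw [hterm, ← Polynomial.C_eq_intCast, Polynomial.coeff_C_mul, Polynomial.coeff_C_mul_X_pow]
  -- Both k and the size of the support are at most n, so equality of the truncated differences
  -- forces them to be equal.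
  have hσ : σ.support.card ≤ Fintype.card n := Finset.card_le_univ _
  by_cases h : σ.support.card = k
  · rw [if_pos h, if_pos (by rw [h])]
    rw [h]
    have h1 : ((-1 : R) ^ k) * (-1) ^ k = 1 := by rw [← mul_pow]; simp
    linear_combination
      (((Equiv.Perm.sign σ : ℤ) : R) * ∏ i ∈ σ.support, M i (σ i)) * h1
  · rw [if_neg h, if_neg (by omega), mul_zero, mul_zero]

theorem Equiv.Perm.prod_support_comp {V M : Type*} [Fintype V] [DecidableEq V] [CommMonoid M]
    (σ : Equiv.Perm V) (f : V → M) : ∏ x ∈ σ.support, f (σ x) = ∏ x ∈ σ.support, f x :=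
  Finset.prod_equiv σ (fun _ => Equiv.Perm.apply_mem_support.symm) fun _ _ => rfl

/-! ### Sixth roots of unity and the unit of a permutation -/

namespace MixedGraph

open Equiv Equiv.Perm SimpleGraph

variable {V : Type*} (X : MixedGraph V)

theorem omega_sq : omega ^ 2 = omega - 1 := by
  have h3 : ((Real.sqrt 3 : ℝ) : ℂ) ^ 2 = 3 := by
    rw [← Complex.ofReal_pow, Real.sq_sqrt (by norm_num)]
    norm_num
  rw [omega]
  linear_combination (1 / 4) * Complex.I ^ 2 * h3 + (3 / 4) * Complex.I_sq

theorem conj_omega : starRingEnd ℂ omega = 1 - omega := by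
  simp only [omega, map_div₀, map_add, map_mul, map_one, Complex.conj_I, Complex.conj_ofReal,
    map_ofNat]
  ring

theorem omega_im_pos : 0 < omega.im := by
  have : omega.im = Real.sqrt 3 / 2 := by simp [omega]
  rw [this]
  positivity

theorem omega_re : omega.re = 1 / 2 := by simp [omega]

theorem eq_of_pow_six_eq_one {z : ℂ} (hz : z ^ 6 = 1) :
    z = 1 ∨ z = -1 ∨ z = omega ∨ z = 1 - omega ∨ z = -omega ∨ z = -(1 - omega) := by
  have h : (z - 1) * ((z + 1) * ((z - omega) * ((z - (1 - omega)) *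
      ((z + omega) * (z + (1 - omega)))))) = 0 := by
    have e1 : (z - omega) * (z - (1 - omega)) = z ^ 2 - z + 1 := by
      linear_combination -omega_sq
    have e2 : (z + omega) * (z + (1 - omega)) = z ^ 2 + z + 1 := by
      linear_combination -omega_sq
    calc _ = (z - 1) * ((z + 1) * (((z - omega) * (z - (1 - omega))) *
      ((z + omega) * (z + (1 - omega))))) := by ring
      _ = 0 := by
        rw [e1, e2]
        linear_combination hz
  simp only [mul_eq_zero, sub_eq_zero, add_eq_zero_iff_eq_neg] at h
  exact h

theorem hermitianAdj_conj (u v : V) :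
    starRingEnd ℂ (X.hermitianAdj u v) = X.hermitianAdj v u := by
  have h0 := X.edge.adj_comm v u
  simp only [hermitianAdj, Matrix.of_apply]
  by_cases h1 : X.edge.Adj u v
  · simp [h0, h1]
  by_cases h2 : X.arc u v
  · simp [h0, h1, h2, X.arc_asymm u v h2]
  by_cases h3 : X.arc v u <;> simp [h0, h1, h2, h3]

theorem hermitianAdj_of_not_adj {u v : V} (h : ¬ X.underlying.Adj u v) :
    X.hermitianAdj u v = 0 := by
  simp only [underlying, not_or] at h
  simp [hermitianAdj, h]

theorem hermitianAdj_pow_six {u v : V} (h : X.underlying.Adj u v) :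
    X.hermitianAdj u v ^ 6 = 1 := by
  have ho : omega ^ 6 = 1 := by
    have h3 : omega ^ 3 = -1 := by linear_combination (omega + 1) * omega_sq
    linear_combination (omega ^ 3 - 1) * h3
  simp only [hermitianAdj, Matrix.of_apply]
  split_ifs with h1 h2 h3
  · simp
  · exact ho
  · rw [← map_pow, ho, map_one]
  · rcases h with h | h | h <;> contradiction

theorem hermitianAdj_mul_swap {u v : V} (h : X.underlying.Adj u v) :
    X.hermitianAdj u v * X.hermitianAdj v u = 1 := by
  rw [← X.hermitianAdj_conj u v, Complex.mul_conj, Complex.normSq_eq_norm_sq,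
    Complex.norm_eq_one_of_pow_eq_one (X.hermitianAdj_pow_six h) (by norm_num)]
  simp

variable [Fintype V]

theorem randic_of_not_adj {u v : V} (h : ¬ X.underlying.Adj u v) : X.randic u v = 0 := by
  simp [randic, X.hermitianAdj_of_not_adj h]

theorem degree_pos {u v : V} (h : X.underlying.Adj u v) : 0 < X.degree u := by
  classical
  rw [degree, SimpleGraph.degree_pos_iff_exists_adj]
  exact ⟨v, h⟩

variable [DecidableEq V]

/-- The product of the entries of the Hermitian adjacency matrix along the cycles of `σ`. -/
noncomputable def permUnit (σ : Perm V) : ℂ := ∏ x ∈ σ.support, X.hermitianAdj x (σ x)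

theorem permUnit_pow_six {σ : Perm V} (h : X.underlying.SupportsPerm σ) :
    X.permUnit σ ^ 6 = 1 := by
  rw [permUnit, ← Finset.prod_pow]
  exact Finset.prod_eq_one fun x hx => X.hermitianAdj_pow_six (h x (Perm.mem_support.1 hx))

theorem permUnit_inv (σ : Perm V) : X.permUnit σ⁻¹ = starRingEnd ℂ (X.permUnit σ) := by
  simp only [permUnit, map_prod, hermitianAdj_conj, Perm.support_inv]
  rw [← σ.prod_support_comp]
  simp

/-- A 2-cycle runs along one edge in both directions, and the two entries are conjugate of modulus
1. -/
theorem permUnit_of_card_lt {c : Perm V} (h : X.underlying.SupportsPerm c) (hc : c.IsCycle)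
    (h3 : c.support.card < 3) : X.permUnit c = 1 := by
  obtain ⟨x, y, hxy, rfl⟩ := card_support_eq_two.1
    (le_antisymm (Nat.lt_succ_iff.1 h3) hc.two_le_card_support)
  have hadj := h x (by simpa using hxy.symm)
  rw [swap_apply_left] at hadj
  rw [permUnit, support_swap hxy, Finset.prod_pair hxy, swap_apply_left, swap_apply_right]
  exact X.hermitianAdj_mul_swap hadj

theorem weight_permSubgraph (σ : Perm V) :
    Sub.weight (X := X) (X.underlying.permSubgraph σ) =
      ∏ x ∈ σ.support, 1 / (X.degree x : ℝ) := by
  rw [Sub.weight]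
  refine Finset.prod_congr ?_ fun _ _ => rfl
  ext x
  simp

theorem weight_permSubgraph_pos {σ : Perm V} (h : X.underlying.SupportsPerm σ) :
    0 < Sub.weight (X := X) (X.underlying.permSubgraph σ) := by
  rw [weight_permSubgraph]
  refine Finset.prod_pos fun x hx => ?_
  have := X.degree_pos (h x (Perm.mem_support.1 hx))
  positivity

/-- Each moved vertex occurs once as x and once as σ x, so the two square roots of its degree
combine to the degree itself. -/
theorem prod_randic_eq (σ : Perm V) :
    ∏ x ∈ σ.support, X.randic x (σ x) =
      (Sub.weight (X := X) (X.underlying.permSubgraph σ) : ℂ) * X.permUnit σ := by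
  have hperm : ∏ x ∈ σ.support, Real.sqrt (X.degree (σ x)) =
      ∏ x ∈ σ.support, Real.sqrt (X.degree x) := by
    exact σ.prod_support_comp fun x => Real.sqrt (X.degree x)
  have hsqrt : ∏ x ∈ σ.support, Real.sqrt ((X.degree x : ℝ) * (X.degree (σ x) : ℝ)) =
      ∏ x ∈ σ.support, (X.degree x : ℝ) := by
    simp only [Real.sqrt_mul (Nat.cast_nonneg _)]
    rw [Finset.prod_mul_distrib, hperm, ← Finset.prod_mul_distrib]
    exact Finset.prod_congr rfl fun x _ => Real.mul_self_sqrt (Nat.cast_nonneg _)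
  simp only [randic, Matrix.of_apply]
  rw [Finset.prod_div_distrib, ← Complex.ofReal_prod, hsqrt, weight_permSubgraph, permUnit]
  simp only [one_div, Finset.prod_inv_distrib, Complex.ofReal_inv]
  rw [div_eq_inv_mul]

theorem prod_randic_of_not_supportsPerm {σ : Perm V} (h : ¬ X.underlying.SupportsPerm σ) :
    ∏ x ∈ σ.support, X.randic x (σ x) = 0 := by
  simp only [SupportsPerm, not_forall] at h
  obtain ⟨x, hx, hadj⟩ := h
  exact Finset.prod_eq_zero (Perm.mem_support.2 hx) (X.randic_of_not_adj hadj)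

/-! ### Elementary subgraphs, ranks and signs -/

variable {X}

omit [Fintype V] in
theorem subgraphOfAdj_eq_permSubgraph_swap {u v : V} (h : X.underlying.Adj u v) :
    X.underlying.SupportsPerm (swap u v) ∧
      X.underlying.subgraphOfAdj h = X.underlying.permSubgraph (swap u v) := by
  have hs : X.underlying.SupportsPerm (swap u v) := by
    intro x hx
    rcases swap_apply_ne_self_iff.1 hx with ⟨-, rfl | rfl⟩
    · rwa [swap_apply_left]
    · rw [swap_apply_right]
      exact h.symm
  refine ⟨hs, ?_⟩
  ext x y
  · rw [mem_verts_permSubgraph, swap_apply_ne_self_iff]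
    simp [h.ne]
  · rw [hs.permSubgraph_adj, subgraphOfAdj_adj, Sym2.eq_iff]
    have := h.ne
    simp only [swap_apply_def]
    grind

theorem isElementary_iff (Y : X.Sub) :
    Y.IsElementary ↔ ∃ σ : Perm V, X.underlying.SupportsPerm σ ∧
      Y = X.underlying.permSubgraph σ := by
  constructor
  · intro h
    refine Subgraph.exists_perm_of_components fun c => ?_
    rcases h c with ⟨u, v, hadj, e⟩ | ⟨u, w, hw, e⟩
    · obtain ⟨hs, hs'⟩ := subgraphOfAdj_eq_permSubgraph_swap hadj
      exact ⟨_, hs, e.trans hs'⟩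
    · obtain ⟨τ, -, -, hτ, e', -⟩ := hw.exists_perm
      exact ⟨τ, hτ, e.symm.trans e'⟩
  · rintro ⟨σ, hσ, rfl⟩ c
    induction c using ConnectedComponent.ind with | _ v
    rw [Sub.component, hσ.component_eq v]
    have hc := isCycle_cycleOf σ v.2
    have hs := hσ.cycleOf v
    rcases Nat.lt_or_ge (σ.cycleOf v).support.card 3 with h3 | h3
    · left
      obtain ⟨x, y, hxy, e⟩ := card_support_eq_two.1
        (le_antisymm (Nat.lt_succ_iff.1 h3) hc.two_le_card_support)
      rw [e] at hs ⊢
      have hadj := hs x (by simpa using hxy.symm)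
      rw [swap_apply_left] at hadj
      exact ⟨x, y, hadj, (subgraphOfAdj_eq_permSubgraph_swap hadj).2.symm⟩
    · right
      obtain ⟨u, w, hw, e, -⟩ := hs.exists_isCycle hc h3
      exact ⟨u, w, hw, e⟩

theorem _root_.SimpleGraph.SupportsPerm.of_mem_cycleFactorsFinset {G : SimpleGraph V}
    {σ c : Perm V} (h : G.SupportsPerm σ) (hc : c ∈ σ.cycleFactorsFinset) : G.SupportsPerm c := by
  intro x hx
  have := (mem_cycleFactorsFinset_iff.1 hc).2 x (Perm.mem_support.2 hx)
  rw [this] at hx ⊢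
  exact h x hx

theorem order_permSubgraph (σ : Perm V) :
    Sub.order (X := X) (X.underlying.permSubgraph σ) = σ.support.card := by
  rw [Sub.order, ← Set.ncard_coe_finset]
  congr 1
  ext x
  simp

/-- A cycle of length m has sign (-1)^(m-1), and the components of the traced subgraph are the
cycles of σ. The bound `hle` keeps the natural subtraction in the rank exact. -/
theorem sign_eq_neg_one_pow_rank {σ : Perm V} (h : X.underlying.SupportsPerm σ) :
    ((Perm.sign σ : ℤ) : ℂ) = (-1) ^ Sub.rank (X := X) (X.underlying.permSubgraph σ) := by
  have hle : σ.cycleFactorsFinset.card ≤ σ.support.card := by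
    refine Finset.card_le_card_of_surjOn σ.cycleOf fun c hc => ?_
    obtain ⟨x, hx⟩ := (mem_cycleFactorsFinset_iff.1 hc).1.nonempty_support
    exact ⟨x, mem_cycleFactorsFinset_support_le hc hx, (cycle_is_cycleOf hx hc).symm⟩
  have hcard : Multiset.card σ.cycleType = σ.cycleFactorsFinset.card := by
    rw [cycleType_def, Multiset.card_map, Finset.card_def]
  rw [Sub.rank, order_permSubgraph, Sub.numComponents, h.card_connectedComponent,
    sign_of_cycleType, sum_cycleType, hcard]
  obtain ⟨m, hm⟩ := Nat.exists_eq_add_of_le hle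
  rw [hm, Nat.add_sub_cancel_left, add_right_comm, ← two_mul, pow_add, pow_mul]
  simp

/-! ### Counting positive, negative and semi-negative cycles -/

/-- Counting cycles in the subgraph traced by `σ` by a property of their values amounts to
counting long cycles of `σ`. -/
theorem ncard_cycles_eq {σ : Perm V} (hσ : X.underlying.SupportsPerm σ) (P : X.Sub → ℂ → Prop)
    (p : ℂ → Prop) [DecidablePred p] (hp : ∀ z, p z → p (starRingEnd ℂ z))
    (hPp : ∀ τ, X.underlying.SupportsPerm τ →
      (P (X.underlying.permSubgraph τ) (∏ x ∈ τ.support, X.randic x (τ x)) ↔ p (X.permUnit τ))) :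
    {C : X.Sub | C ≤ X.underlying.permSubgraph σ ∧ ∃ (u : V) (w : X.underlying.Walk u u),
      C.IsTraversal w ∧ P C (X.walkValue w)}.ncard =
      (σ.longCycles.filter fun c => p (X.permUnit c)).card := by
  have hinj : Set.InjOn X.underlying.permSubgraph
      (σ.longCycles.filter fun c => p (X.permUnit c) : Finset (Perm V)) := by
    intro c hc d hd hcd
    have hc' := (Finset.mem_filter.1 (Finset.mem_filter.1 hc).1).1
    have hd' := (Finset.mem_filter.1 (Finset.mem_filter.1 hd).1).1
    obtain ⟨x, hx⟩ := (mem_cycleFactorsFinset_iff.1 hc').1.nonempty_support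
    have hxd : x ∈ (X.underlying.permSubgraph d).verts := by
      rw [← hcd]
      exact Perm.mem_support.1 hx
    rw [cycle_is_cycleOf hx hc', cycle_is_cycleOf (Perm.mem_support.2 hxd) hd']
  classical
  rw [← Finset.card_image_of_injOn hinj, ← Set.ncard_coe_finset]
  congr 1
  ext C
  simp only [Set.mem_ofPred_eq, Finset.coe_image, Set.mem_image, Finset.mem_coe, Finset.mem_filter]
  constructor
  · rintro ⟨hle, u, w, ⟨hw, rfl⟩, hP⟩
    obtain ⟨τ, hc, h3, hτ, e, hprod⟩ := hw.exists_perm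
    rw [e] at hP hle ⊢
    rw [walkValue, hprod X.randic, hPp τ hτ] at hP
    -- The traversal may run against the direction of σ; this is where p has to be stable under
    -- conjugation.
    rcases hτ.mem_cycleFactorsFinset_of_le hc h3 hle with h | h
    · exact ⟨τ, ⟨Finset.mem_filter.2 ⟨h, h3⟩, hP⟩, rfl⟩
    · refine ⟨τ⁻¹, ⟨Finset.mem_filter.2 ⟨h, by rwa [Perm.support_inv]⟩, ?_⟩,
        permSubgraph_inv τ⟩
      rw [permUnit_inv]
      exact hp _ hP
  · rintro ⟨c, ⟨hc, hpc⟩, rfl⟩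
    obtain ⟨hcf, h3⟩ := Finset.mem_filter.1 hc
    have hs := hσ.of_mem_cycleFactorsFinset hcf
    obtain ⟨hcyc, hcσ⟩ := mem_cycleFactorsFinset_iff.1 hcf
    constructor
    · constructor
      · intro x hx
        exact Perm.mem_support.1 (mem_cycleFactorsFinset_support_le hcf (Perm.mem_support.2 hx))
      · intro x y hxy
        refine ⟨hxy.1, ?_⟩
        rw [← hcσ x (Perm.mem_support.2 hxy.fst_mem), ← hcσ y (Perm.mem_support.2 hxy.snd_mem)]
        exact hxy.2
    · obtain ⟨u, w, hw, e, hprod⟩ := hs.exists_isCycle hcyc h3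
      refine ⟨u, w, ⟨hw, e⟩, ?_⟩
      rw [walkValue, hprod X.randic]
      exact (hPp c hs).2 hpc

/-- The weight is a positive real and the unit is one of six numbers, of which only 1 and −1 are
real; the sign then decides between them. -/
theorem permUnit_eq_one_iff {σ : Perm V} (h : X.underlying.SupportsPerm σ) :
    (∃ t : ℝ, 0 < t ∧ ∏ x ∈ σ.support, X.randic x (σ x) = (t : ℂ)) ↔ X.permUnit σ = 1 := by
  rw [prod_randic_eq]
  have hw := X.weight_permSubgraph_pos h
  generalize Sub.weight (X := X) (X.underlying.permSubgraph σ) = q at hw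
  have ho := omega_im_pos
  constructor
  · rintro ⟨t, ht, e⟩
    have him := congrArg Complex.im e
    have hre := congrArg Complex.re e
    rw [Complex.im_ofReal_mul, Complex.ofReal_im, mul_eq_zero, or_iff_right hw.ne'] at him
    rw [Complex.re_ofReal_mul, Complex.ofReal_re] at hre
    rcases eq_of_pow_six_eq_one (X.permUnit_pow_six h) with h | h | h | h | h | h
    · exact h
    all_goals exfalso; rw [h] at him hre; try simp at him hre
    all_goals linarith
  · intro e
    exact ⟨q, hw, by rw [e, mul_one]⟩

theorem permUnit_eq_neg_one_iff {σ : Perm V} (h : X.underlying.SupportsPerm σ) :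
    (∃ t : ℝ, t < 0 ∧ ∏ x ∈ σ.support, X.randic x (σ x) = (t : ℂ)) ↔ X.permUnit σ = -1 := by
  rw [prod_randic_eq]
  have hw := X.weight_permSubgraph_pos h
  generalize Sub.weight (X := X) (X.underlying.permSubgraph σ) = q at hw
  have ho := omega_im_pos
  constructor
  · rintro ⟨t, ht, e⟩
    have him := congrArg Complex.im e
    have hre := congrArg Complex.re e
    rw [Complex.im_ofReal_mul, Complex.ofReal_im, mul_eq_zero, or_iff_right hw.ne'] at him
    rw [Complex.re_ofReal_mul, Complex.ofReal_re] at hre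
    rcases eq_of_pow_six_eq_one (X.permUnit_pow_six h) with h | h | h | h | h | h
    rotate_left
    · exact h
    all_goals exfalso; rw [h] at him hre; try simp at him hre
    all_goals linarith
  · intro e
    exact ⟨-q, by linarith, by rw [e]; simp⟩

theorem permUnit_eq_neg_omega_iff {σ : Perm V} (h : X.underlying.SupportsPerm σ) :
    (∏ x ∈ σ.support, X.randic x (σ x) =
        -omega * (Sub.weight (X := X) (X.underlying.permSubgraph σ) : ℂ) ∨
      ∏ x ∈ σ.support, X.randic x (σ x) =
        -(starRingEnd ℂ omega) * (Sub.weight (X := X) (X.underlying.permSubgraph σ) : ℂ)) ↔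
      X.permUnit σ = -omega ∨ X.permUnit σ = -(starRingEnd ℂ omega) := by
  have hw : (Sub.weight (X := X) (X.underlying.permSubgraph σ) : ℂ) ≠ 0 :=
    Complex.ofReal_ne_zero.2 (X.weight_permSubgraph_pos h).ne'
  rw [prod_randic_eq, mul_comm, mul_left_inj' hw, mul_left_inj' hw]

-- A check over the six sixth roots of unity. The roots ω and ω̄ belong to none of the three kinds
-- and satisfy z + z̄ = 1, so cycles with these units leave no trace in the formula.
open Classical in
theorem add_conj_eq {z : ℂ} (hz : z ^ 6 = 1) :
    z + starRingEnd ℂ z =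
      (-1) ^ (if z = -1 then 1 else 0) *
        (-1) ^ (if z = -omega ∨ z = -(starRingEnd ℂ omega) then 1 else 0) *
        (2 ^ (if z = -1 then 1 else 0) * 2 ^ (if z = 1 then 1 else 0)) := by
  have ho := omega_im_pos
  have hre := omega_re
  rw [conj_omega]
  rcases eq_of_pow_six_eq_one hz with rfl | rfl | rfl | rfl | rfl | rfl
  · rw [if_neg, if_neg, if_pos rfl]
    · norm_num
    all_goals simp [Complex.ext_iff, hre, ho.ne]
    all_goals norm_num
  · rw [if_pos rfl, if_neg, if_neg]
    · norm_num
    all_goals simp [Complex.ext_iff, hre, ho.ne]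
    all_goals norm_num
  · rw [if_neg, if_neg, if_neg, conj_omega]
    · norm_num
    all_goals simp [Complex.ext_iff, hre, ho.ne']
    all_goals norm_num
  · rw [if_neg, if_neg, if_neg, map_sub, map_one, conj_omega]
    · norm_num
    all_goals simp [Complex.ext_iff, hre, ho.ne']
    all_goals norm_num
  · rw [if_neg, if_pos (Or.inl rfl), if_neg, map_neg, conj_omega]
    · norm_num
      ring
    all_goals simp [Complex.ext_iff, hre, ho.ne']
  · rw [if_neg, if_pos (Or.inr rfl), if_neg, map_neg, map_sub, map_one, conj_omega]
    · norm_num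
      ring
    all_goals simp [Complex.ext_iff, hre, ho.ne']

/-! ### Summation over the directions of the long cycles -/

theorem permUnit_reverseOn (σ : Perm V) (T : Finset (Perm V)) :
    X.permUnit (σ.reverseOn T) = ∏ c ∈ σ.cycleFactorsFinset,
      if c ∈ T then starRingEnd ℂ (X.permUnit c) else X.permUnit c := by
  have hsupp : (σ.reverseOn T).support = σ.support := by
    ext x
    have := reverseOn_apply_eq_iff σ T x x
    rw [or_self, or_self] at this
    rw [Perm.mem_support, Perm.mem_support]
    exact not_congr this
  rw [permUnit, hsupp, prod_support_eq_prod_cycleFactorsFinset]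
  refine Finset.prod_congr rfl fun c hc => ?_
  have hcσ : ∀ x ∈ c.support, σ.reverseOn T x = if c ∈ T then c⁻¹ x else c x := by
    intro x hx
    have hc' := cycle_is_cycleOf hx hc
    rw [reverseOn_apply, ← hc', (mem_cycleFactorsFinset_iff.1 hc).2 x hx]
    congr 1
    have hx' : c⁻¹ x ∈ c.support := by
      rw [← Perm.apply_mem_support]
      simpa using hx
    rw [Perm.inv_eq_iff_eq, ← (mem_cycleFactorsFinset_iff.1 hc).2 _ hx']
    simp
  split_ifs with hT
  · rw [← permUnit_inv, permUnit, Perm.support_inv]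
    exact Finset.prod_congr rfl fun x hx => by rw [hcσ x hx, if_pos hT]
  · exact Finset.prod_congr rfl fun x hx => by rw [hcσ x hx, if_neg hT]

theorem sum_permUnit_reverseOn {σ : Perm V} (hσ : X.underlying.SupportsPerm σ) :
    ∑ T ∈ σ.longCycles.powerset, X.permUnit (σ.reverseOn T) =
      ∏ c ∈ σ.longCycles, (X.permUnit c + starRingEnd ℂ (X.permUnit c)) := by
  -- `Finset.prod_add` takes the first summand on the chosen subset T, so the conjugate has to stand
  -- first.
  simp only [add_comm (X.permUnit _)]
  rw [Finset.prod_add]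
  refine Finset.sum_congr rfl fun T hT => ?_
  rw [Finset.mem_powerset] at hT
  have hsub : σ.longCycles ⊆ σ.cycleFactorsFinset := Finset.filter_subset _ _
  rw [permUnit_reverseOn, ← Finset.prod_subset hsub, ← Finset.prod_sdiff hT, mul_comm]
  · congr 1
    · exact Finset.prod_congr rfl fun c hc => if_pos hc
    · exact Finset.prod_congr rfl fun c hc => if_neg (Finset.mem_sdiff.1 hc).2
  · intro c hc hcl
    -- A cycle factor that is not long is a 2-cycle, with unit 1.
    rw [if_neg fun h => hcl (hT h)]
    refine X.permUnit_of_card_lt (hσ.of_mem_cycleFactorsFinset hc)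
      (mem_cycleFactorsFinset_iff.1 hc).1 ?_
    by_contra h3
    exact hcl (Finset.mem_filter.2 ⟨hc, not_lt.1 h3⟩)

open Classical in
theorem prod_longCycles_eq {σ : Perm V} (hσ : X.underlying.SupportsPerm σ) :
    ∏ c ∈ σ.longCycles, (X.permUnit c + starRingEnd ℂ (X.permUnit c)) =
      (-1) ^ (Sub.numNegative (X := X) (X.underlying.permSubgraph σ) +
          Sub.numSemiNegative (X := X) (X.underlying.permSubgraph σ)) *
        2 ^ (Sub.numNegative (X := X) (X.underlying.permSubgraph σ) +
          Sub.numPositive (X := X) (X.underlying.permSubgraph σ)) := by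
  have hpos : Sub.numPositive (X := X) (X.underlying.permSubgraph σ) =
      (σ.longCycles.filter fun c => X.permUnit c = 1).card :=
    ncard_cycles_eq hσ (fun _ z => ∃ t : ℝ, 0 < t ∧ z = t) (fun z => z = 1)
      (fun z hz => by rw [hz, map_one]) fun τ hτ => permUnit_eq_one_iff hτ
  have hneg : Sub.numNegative (X := X) (X.underlying.permSubgraph σ) =
      (σ.longCycles.filter fun c => X.permUnit c = -1).card :=
    ncard_cycles_eq hσ (fun _ z => ∃ t : ℝ, t < 0 ∧ z = t) (fun z => z = -1)
      (fun z hz => by rw [hz, map_neg, map_one]) fun τ hτ => permUnit_eq_neg_one_iff hτ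
  have hsemi : Sub.numSemiNegative (X := X) (X.underlying.permSubgraph σ) =
      (σ.longCycles.filter fun c =>
        X.permUnit c = -omega ∨ X.permUnit c = -(starRingEnd ℂ omega)).card :=
    ncard_cycles_eq hσ
      (fun C z => z = -omega * (Sub.weight (X := X) C : ℂ) ∨
        z = -(starRingEnd ℂ omega) * (Sub.weight (X := X) C : ℂ))
      (fun z => z = -omega ∨ z = -(starRingEnd ℂ omega))
      -- Conjugation exchanges −ω and −ω̄.
      (fun z hz => hz.symm.imp (fun h => by rw [h, map_neg, Complex.conj_conj])
        (fun h => by rw [h, map_neg]))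
      fun τ hτ => permUnit_eq_neg_omega_iff hτ
  rw [hpos, hneg, hsemi, Finset.card_filter, Finset.card_filter, Finset.card_filter, pow_add,
    pow_add, ← Finset.prod_pow_eq_pow_sum, ← Finset.prod_pow_eq_pow_sum,
    ← Finset.prod_pow_eq_pow_sum, ← Finset.prod_pow_eq_pow_sum, ← Finset.prod_mul_distrib,
    ← Finset.prod_mul_distrib, ← Finset.prod_mul_distrib]
  refine Finset.prod_congr rfl fun c hc => add_conj_eq (X.permUnit_pow_six ?_)
  exact hσ.of_mem_cycleFactorsFinset (Finset.mem_filter.1 hc).1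

open Classical in
/-- The contribution to the characteristic polynomial of the permutations that trace a given
elementary subgraph. -/
theorem sum_permSubgraph_eq {Y : X.Sub} (hY : Y.IsElementary) :
    ∑ σ : Perm V with X.underlying.SupportsPerm σ ∧ X.underlying.permSubgraph σ = Y,
        ((Perm.sign σ : ℤ) : ℂ) * ∏ x ∈ σ.support, X.randic x (σ x) =
      (-1 : ℂ) ^ (Y.rank + Y.numNegative + Y.numSemiNegative) *
          2 ^ (Y.numNegative + Y.numPositive) * (Y.weight : ℂ) := by
  obtain ⟨σ, hσ, rfl⟩ := (isElementary_iff Y).1 hY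
  have himage : (Finset.univ.filter fun τ : Perm V => X.underlying.SupportsPerm τ ∧
      X.underlying.permSubgraph τ = X.underlying.permSubgraph σ) =
      σ.longCycles.powerset.image σ.reverseOn := by
    ext τ
    rw [Finset.mem_filter, ← hσ.permSubgraph_eq_iff, and_iff_right (Finset.mem_univ _)]
  have hterm : ∀ T ∈ σ.longCycles.powerset,
      ((Perm.sign (σ.reverseOn T) : ℤ) : ℂ) *
        ∏ x ∈ (σ.reverseOn T).support, X.randic x (σ.reverseOn T x) =
      (-1) ^ Sub.rank (X := X) (X.underlying.permSubgraph σ) *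
        (Sub.weight (X := X) (X.underlying.permSubgraph σ) : ℂ) *
          X.permUnit (σ.reverseOn T) := by
    intro T _
    rw [sign_eq_neg_one_pow_rank (hσ.reverseOn T), prod_randic_eq, permSubgraph_reverseOn,
      mul_assoc]
  rw [himage, Finset.sum_image σ.reverseOn_injOn, Finset.sum_congr rfl hterm, ← Finset.mul_sum,
    sum_permUnit_reverseOn hσ, prod_longCycles_eq hσ]
  ring

end MixedGraph

/-! ### Grouping the permutations by the subgraph they trace -/

theorem theorem4p2 {V : Type*} [Fintype V] [DecidableEq V] (X : MixedGraph V)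
    (k : ℕ) (hk1 : 1 ≤ k) (hkn : k ≤ Fintype.card V) :
    (-1 : ℂ) ^ k * X.randic.charpoly.coeff (Fintype.card V - k) =
      ∑ Y ∈ X.elementarySubgraphs k,
        (-1 : ℂ) ^ (Y.rank + Y.numNegative + Y.numSemiNegative) *
          2 ^ (Y.numNegative + Y.numPositive) * (Y.weight : ℂ) := by
  classical
  rw [X.randic.neg_one_pow_mul_charpoly_coeff_of_diag_eq_zero
    (fun v => X.randic_of_not_adj (X.underlying.irrefl)) hkn]
  have hmem : ∀ Y : X.Sub, Y ∈ X.elementarySubgraphs k ↔ Y.IsElementary ∧ Y.order = k := by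
    intro Y
    rw [MixedGraph.elementarySubgraphs, Set.Finite.mem_toFinset]
    rfl
  -- A permutation that moves some vertex to a non-neighbour meets a zero entry of R and drops out.
  have hsupp : ∑ σ : Equiv.Perm V with σ.support.card = k,
      ((Equiv.Perm.sign σ : ℤ) : ℂ) * ∏ x ∈ σ.support, X.randic x (σ x) =
      ∑ σ : Equiv.Perm V with σ.support.card = k ∧ X.underlying.SupportsPerm σ,
      ((Equiv.Perm.sign σ : ℤ) : ℂ) * ∏ x ∈ σ.support, X.randic x (σ x) := by
    rw [← Finset.filter_filter]
    refine (Finset.sum_filter_of_ne ?_).symm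
    intro σ _ hne
    by_contra h
    exact hne (by rw [X.prod_randic_of_not_supportsPerm h, mul_zero])
  rw [hsupp, ← Finset.sum_fiberwise_of_maps_to (t := X.elementarySubgraphs k)
    (g := X.underlying.permSubgraph)]
  · refine Finset.sum_congr rfl fun Y hY => ?_
    obtain ⟨hel, hord⟩ := (hmem Y).1 hY
    rw [← MixedGraph.sum_permSubgraph_eq hel, Finset.filter_filter]
    refine Finset.sum_congr (Finset.filter_congr fun σ _ => ?_) fun _ _ => rfl
    refine ⟨fun h => ⟨h.1.2, h.2⟩, fun h => ⟨⟨?_, h.1⟩, h.2⟩⟩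
    rw [← hord, ← h.2, MixedGraph.order_permSubgraph]
  · intro σ hσ
    obtain ⟨-, hcard, hs⟩ := Finset.mem_filter.1 hσ
    exact (hmem _).2 ⟨(MixedGraph.isElementary_iff _).2 ⟨σ, hs, rfl⟩,
      (MixedGraph.order_permSubgraph σ).trans hcard⟩
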